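/- Let $X$ be a real or complex Banach space, with topological dual $X^*$, closed unit balls $B_X, B_{X^*}$ and unit spheres $S_X, S_{X^*}$. Put $$\Pi(X)=\{(y,y^*)\in X\times X^* : \|y\|=\|y^*\|=y^*(y)=1\}.$$ For $\delta\in(0,2)$ let $\Phi_X(\delta)$ be the infimum of those $\varepsilon>0$ such that for every $(x,x^*)\in B_X\times B_{X^*}$ with $\operatorname{Re} x^*(x)>1-\delta$ there is $(y,y^*)\in\Pi(X)$ with $\|x-y\|<\varepsilon$ and $\|x^*-y^*\|<\varepsilon$. Let $\Phi^S_X(\delta)$ be the infimum of those $\varepsilon>0$ such that the same holds for every $(x,x^*)\in S_X\times S_{X^*}$ with $\operatorname{Re} x^*(x)>1-\delta$. Then for every $\delta\in(0,2)$, $$\Phi_X(\delta)=\sqrt{2\delta}\quad\Longleftrightarrow\quad \Phi^S_X(\delta)=\sqrt{2\delta}.$$ -/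

import Mathlib

section BishopPhelpsBollobas

variable (𝕜 : Type*) [RCLike 𝕜] (X : Type*) [NormedAddCommGroup X] [NormedSpace 𝕜 X]

/-- The set `Π(X)` of pairs `(y, y*)` in `X × X*` with `‖y‖ = ‖y*‖ = y*(y) = 1`. -/
def dualityPairs : Set (X × StrongDual 𝕜 X) :=
  {p | ‖p.1‖ = 1 ∧ ‖p.2‖ = 1 ∧ p.2 p.1 = 1}

/-- The Bishop-Phelps-Bollobas modulus `Φ_X(δ)`: the infimum of those `ε > 0` such that every
`(x, x*)` in `B_X × B_{X*}` with `Re x*(x) > 1 - δ` has some `(y, y*)` in `Π(X)` with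
`‖x - y‖ < ε` and `‖x* - y*‖ < ε`. -/
noncomputable def bpbModulus (δ : ℝ) : ℝ :=
  sInf {ε : ℝ | 0 < ε ∧ ∀ (x : X) (f : StrongDual 𝕜 X), ‖x‖ ≤ 1 → ‖f‖ ≤ 1 →
    1 - δ < RCLike.re (f x) → ∃ p ∈ dualityPairs 𝕜 X, ‖x - p.1‖ < ε ∧ ‖f - p.2‖ < ε}

/-- The spherical Bishop-Phelps-Bollobas modulus `Φ^S_X(δ)`: the same infimum, with the pairs
`(x, x*)` restricted to `S_X × S_{X*}`. -/
noncomputable def sphericalBpbModulus (δ : ℝ) : ℝ :=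
  sInf {ε : ℝ | 0 < ε ∧ ∀ (x : X) (f : StrongDual 𝕜 X), ‖x‖ = 1 → ‖f‖ = 1 →
    1 - δ < RCLike.re (f x) → ∃ p ∈ dualityPairs 𝕜 X, ‖x - p.1‖ < ε ∧ ‖f - p.2‖ < ε}

end BishopPhelpsBollobas

/-! Put c = √(2δ). For X ≠ 0 one always has Φ^S ≤ Φ ≤ c, so the only content is that Φ^S < c forces
Φ < c. Phelps's theorem (`exists_attaining_near`, from Ekeland's principle and a separation
argument), applied to the normalized pair, gives an error bound that is c for unit vectors but drops
below c, uniformly, once one of the norms is at most 1 - τ (`exists_dualityPair_near_of_norm_le`).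
The remaining ball pairs lie close to sphere pairs of the same region (`exists_sphere_pair_near`),
where the assumed bound leaves room for the perturbation. -/

/-! ### Ekeland's principle and Phelps's theorem -/

open Filter Topology in
/-- Ekeland's variational principle for a function that is continuous and bounded above on a
complete set. -/
theorem IsComplete.exists_ekeland_point {α : Type*} [MetricSpace α] {S : Set α} (hS : IsComplete S)
    {φ : α → ℝ} (hφ : Continuous φ) {M : ℝ} (hM : ∀ v ∈ S, φ v ≤ M) {k : ℝ} (hk : 0 < k)
    {x : α} (hx : x ∈ S) :
    ∃ y ∈ S, k * dist x y ≤ φ y - φ x ∧ ∀ v ∈ S, φ v ≤ φ y + k * dist y v := by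
  -- Iterate nearly optimal ascents of slope at least `k`: increments of `φ` dominate distances, so
  -- boundedness of `φ` makes the iterates Cauchy.
  have step : ∀ (n : ℕ) (w : S), ∃ w' : S, k * dist (w : α) w' ≤ φ w' - φ w ∧
      ∀ v ∈ S, k * dist (w : α) v ≤ φ v - φ w → φ v ≤ φ w' + (1 / 2) ^ n := by
    intro n w
    set T : Set ℝ := φ '' {v | v ∈ S ∧ k * dist (w : α) v ≤ φ v - φ w} with hT
    have hne : T.Nonempty := ⟨φ w, w, ⟨w.2, by simp⟩, rfl⟩
    have hbdd : BddAbove T := ⟨M, by rintro _ ⟨v, hv, rfl⟩; exact hM v hv.1⟩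
    obtain ⟨_, ⟨v, hv, rfl⟩, hlt⟩ := exists_lt_of_lt_csSup hne
      (sub_lt_self (sSup T) (by positivity : (0 : ℝ) < (1 / 2) ^ n))
    refine ⟨⟨v, hv.1⟩, hv.2, fun v' hv' h => ?_⟩
    have := le_csSup hbdd ⟨v', ⟨hv', h⟩, rfl⟩
    simp only
    linarith
  choose F hF1 hF2 using step
  let s : ℕ → S := fun n => Nat.rec (motive := fun _ => S) ⟨x, hx⟩ (fun n w => F n w) n
  have hs : ∀ n, s (n + 1) = F n (s n) := fun n => rfl
  have hstep : ∀ n, k * dist (s n : α) (s (n + 1)) ≤ φ (s (n + 1) : α) - φ (s n : α) := fun n => by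
    rw [hs]; exact hF1 n (s n)
  have hmn : ∀ n m, n ≤ m → k * dist (s n : α) (s m) ≤ φ (s m) - φ (s n) := by
    intro n m hnm
    induction m, hnm using Nat.le_induction with
    | base => simp
    | succ m _ ih =>
      have := dist_triangle (s n : α) (s m) (s (m + 1))
      nlinarith [hstep m]
  have hmono : Monotone fun n => φ (s n : α) := fun n m h => by
    have := hmn n m h
    have : 0 ≤ k * dist (s n : α) (s m) := by positivity
    simp only
    linarith
  have hlim := tendsto_atTop_ciSup hmono ⟨M, by rintro _ ⟨n, rfl⟩; exact hM _ (s n).2⟩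
  have hcau : CauchySeq fun n => (s n : α) := by
    have hc := hlim.cauchySeq
    rw [Metric.cauchySeq_iff'] at hc ⊢
    intro ε hε
    obtain ⟨N, hN⟩ := hc (k * ε) (by positivity)
    refine ⟨N, fun n hn => ?_⟩
    have h1 := hN n hn
    rw [Real.dist_eq] at h1
    have h2 := hmn N n hn
    rw [dist_comm]
    exact lt_of_mul_lt_mul_left (h2.trans_lt ((le_abs_self _).trans_lt h1)) hk.le
  obtain ⟨y, hy, hty⟩ := cauchySeq_tendsto_of_isComplete hS (fun n => (s n).2) hcau
  have htφ : Tendsto (fun n => φ (s n : α)) atTop (𝓝 (φ y)) := (hφ.tendsto y).comp hty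
  have hny : ∀ n, k * dist (s n : α) y ≤ φ y - φ (s n) := fun n =>
    le_of_tendsto_of_tendsto ((tendsto_const_nhds.dist hty).const_mul k)
      (htφ.sub_const _) (eventually_atTop.2 ⟨n, fun m hm => hmn n m hm⟩)
  refine ⟨y, hy, hny 0, fun v hv => ?_⟩
  by_contra! hlt
  -- A violating `v` is an admissible ascent from every `s n`, so near-optimality bounds `φ v`.
  have hle : φ v ≤ φ y := by
    have hpow : Tendsto (fun n : ℕ => φ (s (n + 1)) + (1 / 2 : ℝ) ^ n) atTop (𝓝 (φ y + 0)) :=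
      (htφ.comp (tendsto_add_atTop_nat 1)).add
        (tendsto_pow_atTop_nhds_zero_of_lt_one (by norm_num) (by norm_num))
    rw [add_zero] at hpow
    refine ge_of_tendsto' hpow fun n => ?_
    rw [hs]
    refine hF2 n (s n) v hv ?_
    have := dist_triangle (s n : α) y v
    nlinarith [hny n]
  have : 0 ≤ k * dist y v := by positivity
  linarith

/-- If `g v ≤ g y + k ‖v - y‖` on a convex set
containing `y`, then some `φ` with `‖φ‖ ≤ k` makes `g - φ` attain its maximum over the set
at `y`. -/
theorem Convex.exists_norm_le_sub_le {X : Type*} [NormedAddCommGroup X] [NormedSpace ℝ X]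
    {B : Set X} (hB : Convex ℝ B) {g : StrongDual ℝ X} {y : X} (hy : y ∈ B) {k : ℝ} (hk : 0 ≤ k)
    (h : ∀ v ∈ B, g v ≤ g y + k * ‖v - y‖) :
    ∃ φ : StrongDual ℝ X, ‖φ‖ ≤ k ∧ ∀ v ∈ B, (g - φ) v ≤ (g - φ) y := by
  have hA : Convex ℝ {p : X × ℝ | k * ‖p.1 - y‖ < p.2} := by
    intro p hp q hq s t hs ht hst
    simp only [Set.mem_ofPred_eq, Prod.fst_add, Prod.snd_add, Prod.smul_fst, Prod.smul_snd,
      smul_eq_mul] at hp hq ⊢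
    have e : s • p.1 + t • q.1 - y = s • (p.1 - y) + t • (q.1 - y) := by
      have : y = (s + t) • y := by rw [hst, one_smul]
      nth_rw 1 [this]
      module
    have hn : ‖s • p.1 + t • q.1 - y‖ ≤ s * ‖p.1 - y‖ + t * ‖q.1 - y‖ := by
      rw [e]
      refine (norm_add_le _ _).trans_eq ?_
      rw [norm_smul, norm_smul, Real.norm_of_nonneg hs, Real.norm_of_nonneg ht]
    have h1 := mul_le_mul_of_nonneg_left hn hk
    rcases hs.eq_or_lt with rfl | hs'
    · have : t = 1 := by linarith
      subst this
      linarith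
    · nlinarith [mul_lt_mul_of_pos_left hp hs', mul_le_mul_of_nonneg_left hq.le ht]
  have hAo : IsOpen {p : X × ℝ | k * ‖p.1 - y‖ < p.2} :=
    isOpen_lt (by fun_prop) (by fun_prop)
  have hD : Convex ℝ {p : X × ℝ | p.1 ∈ B ∧ p.2 ≤ g p.1 - g y} := by
    intro p hp q hq s t hs ht hst
    refine ⟨hB hp.1 hq.1 hs ht hst, ?_⟩
    simp only [Prod.fst_add, Prod.snd_add, Prod.smul_fst, Prod.smul_snd, smul_eq_mul, map_add,
      map_smul]
    have e : g y = s * g y + t * g y := by rw [← add_mul, hst, one_mul]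
    nlinarith [mul_le_mul_of_nonneg_left hp.2 hs, mul_le_mul_of_nonneg_left hq.2 ht]
  have hdisj : Disjoint {p : X × ℝ | k * ‖p.1 - y‖ < p.2}
      {p : X × ℝ | p.1 ∈ B ∧ p.2 ≤ g p.1 - g y} := by
    rw [Set.disjoint_left]
    rintro p hp ⟨hpB, hp2⟩
    have := h _ hpB
    simp only [Set.mem_ofPred_eq] at hp
    linarith
  -- Separate an open cone with apex `(y, 0)` from the hypograph of `g - g y` over `B`; the slope of
  -- the separating hyperplane is `φ`.
  obtain ⟨F, u, hFA, hFD⟩ := geometric_hahn_banach_open hA hAo hD hdisj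
  have hF : ∀ (v : X) (s : ℝ), F (v, s) = F (v, 0) + s * F (0, 1) := by
    intro v s
    have : ((v, s) : X × ℝ) = (v, 0) + s • (0, 1) := by simp
    rw [this, map_add, map_smul, smul_eq_mul]
  have hu : u ≤ F (y, 0) := hFD _ ⟨hy, by simp⟩
  have hβ : 0 < -F (0, 1) := by
    have := hFA (y, 1) (by simp)
    rw [hF] at this
    linarith
  set β := -F (0, 1) with hβd
  have hle : ∀ v, F (v, 0) - (k * ‖v - y‖) * β ≤ u := by
    intro v
    refine le_of_forall_pos_lt_add fun ε hε => ?_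
    have := hFA (v, k * ‖v - y‖ + ε / β) (by
      simp only [Set.mem_ofPred_eq, lt_add_iff_pos_right]; positivity)
    rw [hF, show F (0, 1) = -β by simp [β]] at this
    have e : ε / β * β = ε := div_mul_cancel₀ _ hβ.ne'
    linarith
  have hyu : F (y, 0) ≤ u := by simpa using hle y
  let φ : StrongDual ℝ X := β⁻¹ • F.comp (ContinuousLinearMap.inl ℝ X ℝ)
  have hφ : ∀ v, β * φ v = F (v, 0) := fun v => by
    simp [φ, mul_inv_cancel_left₀ hβ.ne']
  refine ⟨φ, ?_, ?_⟩
  · have key : ∀ w, φ w ≤ k * ‖w‖ := by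
      intro w
      have h1 := hle (y + w)
      rw [← hφ, map_add] at h1
      rw [← hφ] at hu
      rw [add_sub_cancel_left] at h1
      refine le_of_mul_le_mul_left ?_ hβ
      linarith
    refine φ.opNorm_le_bound hk fun w => ?_
    rw [Real.norm_eq_abs, abs_le]
    have := key (-w)
    rw [map_neg, norm_neg] at this
    exact ⟨by linarith, key w⟩
  · intro v hv
    have h1 := hFD (v, g v - g y) ⟨hv, le_rfl⟩
    rw [hF, show F (0, 1) = -β by simp [β], ← hφ] at h1
    rw [← hφ] at hyu
    simp only [sub_apply]
    have : β * (g v - φ v) ≤ β * (g y - φ y) := by linarith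
    exact le_of_mul_le_mul_left this hβ

/-- An upper bound for the real part of a functional on the unit ball bounds its norm. -/
theorem StrongDual.norm_le_of_re_le {𝕜 : Type*} [RCLike 𝕜] {X : Type*} [NormedAddCommGroup X]
    [NormedSpace 𝕜 X] {z : StrongDual 𝕜 X} {C : ℝ}
    (h : ∀ v : X, ‖v‖ ≤ 1 → RCLike.re (z v) ≤ C) : ‖z‖ ≤ C := by
  by_contra! hC
  obtain ⟨v, hv, hlt⟩ := z.exists_lt_apply_of_lt_opNorm hC
  obtain ⟨c, hc, hcv⟩ := RCLike.exists_norm_eq_mul_self (z v)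
  have := h (c • v) (by rw [norm_smul, hc, one_mul]; exact hv.le)
  rw [map_smul, smul_eq_mul, ← hcv, RCLike.ofReal_re] at this
  linarith

/-- Phelps's form of the Bishop-Phelps-Bollobas theorem on the unit ball. -/
theorem exists_attaining_near {𝕜 : Type*} [RCLike 𝕜] {X : Type*} [NormedAddCommGroup X]
    [NormedSpace 𝕜 X] [CompleteSpace X] {g : StrongDual 𝕜 X} (hg : ‖g‖ = 1) {x : X}
    (hx : ‖x‖ ≤ 1) {k : ℝ} (hk : 0 < k) (hk1 : k < 1) :
    ∃ (y : X) (z : StrongDual 𝕜 X), ‖y‖ = 1 ∧ z ≠ 0 ∧ z y = (‖z‖ : 𝕜) ∧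
      k * ‖x - y‖ ≤ 1 - RCLike.re (g x) ∧ ‖g - z‖ ≤ k := by
  let _ : NormedSpace ℝ X := NormedSpace.restrictScalars ℝ 𝕜 X
  have : IsScalarTower ℝ 𝕜 X := RestrictScalars.isScalarTower ℝ 𝕜 X
  have hre : ∀ v : X, ‖v‖ ≤ 1 → RCLike.re (g v) ≤ 1 := fun v hv =>
    (RCLike.re_le_norm _).trans ((g.le_opNorm v).trans (by rw [hg, one_mul]; exact hv))
  let gr : StrongDual ℝ X := StrongDual.extendRCLikeₗ.symm g
  have hgr : ∀ v, gr v = RCLike.re (g v) := fun v => by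
    simp [gr, StrongDual.extendRCLikeₗ_symm_apply]
  have hmem : ∀ v : X, v ∈ Metric.closedBall (0 : X) 1 ↔ ‖v‖ ≤ 1 := by simp
  obtain ⟨y, hyB, hxy, hmax⟩ := (Metric.isClosed_closedBall (x := (0 : X)) (ε := 1)).isComplete
    |>.exists_ekeland_point gr.continuous (M := 1)
      (fun v hv => by rw [hgr]; exact hre v ((hmem v).1 hv)) hk ((hmem x).2 hx)
  obtain ⟨φ, hφ, hφmax⟩ := (convex_closedBall (0 : X) 1).exists_norm_le_sub_le (g := gr) hyB hk.le
    (fun v hv => by rw [← dist_eq_norm, dist_comm]; exact hmax v hv)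
  set z : StrongDual 𝕜 X := g - φ.extendRCLike with hz
  have hzre : ∀ v, RCLike.re (z v) = (gr - φ) v := fun v => by simp [hz, hgr]
  have hgz : ‖g - z‖ ≤ k := by
    rw [hz, sub_sub_cancel, StrongDual.norm_extendRCLike]; exact hφ
  have hz0 : z ≠ 0 := by
    intro h0
    rw [h0, sub_zero, hg] at hgz
    linarith
  have hzpos : 0 < ‖z‖ := norm_pos_iff.2 hz0
  have hy1 : ‖y‖ ≤ 1 := (hmem y).1 hyB
  have hbound : ‖z‖ ≤ RCLike.re (z y) := StrongDual.norm_le_of_re_le fun v hv => by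
    rw [hzre, hzre]; exact hφmax v ((hmem v).2 hv)
  have hle := z.le_opNorm y
  have hre_le := RCLike.re_le_norm (z y)
  -- The maximum at `y` gives ‖z‖ ≤ Re z(y) ≤ ‖z‖‖y‖.
  have hy : ‖y‖ = 1 := hy1.antisymm <| by
    refine le_of_mul_le_mul_left ?_ hzpos
    linarith
  rw [hy, mul_one] at hle
  refine ⟨y, z, hy, hz0, ?_, ?_, hgz⟩
  · rw [RCLike.norm_le_re_iff_eq_norm.1 (hle.trans hbound)]
    congr 1
    linarith
  · have := hre y hy1
    rw [hgr, hgr, dist_eq_norm] at hxy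
    linarith


/-! ### Approximation of pairs in the balls -/

section
variable {𝕜 : Type*} [RCLike 𝕜] {X : Type*} [NormedAddCommGroup X] [NormedSpace 𝕜 X]

/-- At `x = 0` any unit vector serves, so normalizing later needs no case split. -/
theorem exists_sphere_dist_eq (𝕜 : Type*) [RCLike 𝕜] {X : Type*} [NormedAddCommGroup X]
    [NormedSpace 𝕜 X] [Nontrivial X] (x : X) :
    ∃ x₀ : X, ‖x₀‖ = 1 ∧ x = (‖x‖ : 𝕜) • x₀ := by
  by_cases hx : x = 0
  · subst hx
    obtain ⟨y, hy⟩ := exists_ne (0 : X)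
    exact ⟨(‖y‖⁻¹ : 𝕜) • y, norm_smul_inv_norm hy, by simp⟩
  · refine ⟨(‖x‖⁻¹ : 𝕜) • x, norm_smul_inv_norm hx, ?_⟩
    rw [smul_smul, mul_inv_cancel₀ (by simpa using hx), one_smul]

theorem norm_real_smul_sub_self {x : X} (hx : ‖x‖ = 1) (r : ℝ) :
    ‖(r : 𝕜) • x - x‖ = |r - 1| := by
  have : (r : 𝕜) • x - x = ((r - 1 : ℝ) : 𝕜) • x := by
    push_cast
    module
  rw [this, norm_smul, hx, mul_one, RCLike.norm_ofReal]

/-- The cheap approximation, which moves `x` radially and does not control the functional. -/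
theorem exists_dualityPair_radial [Nontrivial X] (x : X) (hx : ‖x‖ ≤ 1) (f : StrongDual 𝕜 X) :
    ∃ p ∈ dualityPairs 𝕜 X, ‖x - p.1‖ = 1 - ‖x‖ ∧ ‖f - p.2‖ ≤ 1 + ‖f‖ := by
  obtain ⟨x₀, hx₀, hxx₀⟩ := exists_sphere_dist_eq 𝕜 x
  obtain ⟨g, hg, hgx⟩ := exists_dual_vector 𝕜 x₀ (by simp [hx₀])
  refine ⟨(x₀, g), ⟨hx₀, hg, by simp [hgx, hx₀]⟩, ?_, ?_⟩
  · simp only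
    nth_rw 1 [hxx₀]
    rw [norm_real_smul_sub_self hx₀, abs_sub_comm, abs_of_nonneg (by linarith)]
  · have := norm_sub_le f g
    simp only
    linarith

/-- The approximation obtained from Phelps's theorem after normalizing both `x` and `f`. -/
theorem exists_dualityPair_near [CompleteSpace X] [Nontrivial X] {x : X} (hx : ‖x‖ ≤ 1)
    {f : StrongDual 𝕜 X} (hf : ‖f‖ ≤ 1) {e : ℝ} (hfe : 1 - ‖f‖ < e) (hfe' : e < 1 + ‖f‖)
    (h : 2 * (‖x‖ * ‖f‖ - RCLike.re (f x)) ≤ (e - (1 - ‖x‖)) * (e - (1 - ‖f‖))) :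
    ∃ p ∈ dualityPairs 𝕜 X, ‖x - p.1‖ ≤ e ∧ ‖f - p.2‖ ≤ e := by
  obtain ⟨x₀, hx₀, hxx₀⟩ := exists_sphere_dist_eq 𝕜 x
  have hf0 : 0 < ‖f‖ := by linarith
  obtain ⟨g, hg, hfg⟩ := exists_sphere_dist_eq 𝕜 (X := StrongDual 𝕜 X) f
  set θ := ‖f‖
  set μ := ‖x‖
  have hμ : 0 ≤ μ := norm_nonneg x
  -- `k` solves 2θk + (1 - θ) = e, the error bound for the functional; `hfe` and `hfe'` say 0 < k <
  -- 1.
  obtain ⟨y, z, hy, hz0, hzy, hxy, hgz⟩ := exists_attaining_near hg hx₀.le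
    (k := (e - (1 - θ)) / (2 * θ)) (div_pos (by linarith) (by linarith))
    (by rw [div_lt_one (by linarith)]; linarith)
  set k := (e - (1 - θ)) / (2 * θ)
  have hk : 2 * (θ * k) = e - (1 - θ) := by simp only [k]; field_simp
  have hzpos : 0 < ‖z‖ := norm_pos_iff.2 hz0
  have hre : RCLike.re (f x) = μ * θ * RCLike.re (g x₀) := by
    rw [hfg, hxx₀, smul_apply, g.map_smul, smul_eq_mul, smul_eq_mul,
      RCLike.re_ofReal_mul, RCLike.re_ofReal_mul]
    ring
  refine ⟨(y, ((‖z‖⁻¹ : ℝ) : 𝕜) • z), ⟨hy, ?_, ?_⟩, ?_, ?_⟩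
  · simp [norm_smul, hzpos.ne']
  · simp [hzy, hzpos.ne']
  · simp only
    have h1 : x - y = (μ : 𝕜) • (x₀ - y) + ((μ : 𝕜) • y - y) := by
      rw [hxx₀]; module
    have h2 : ‖x - y‖ ≤ μ * ‖x₀ - y‖ + (1 - μ) := by
      rw [h1]
      refine (norm_add_le _ _).trans_eq ?_
      rw [norm_smul, norm_real_smul_sub_self hy, abs_sub_comm, abs_of_nonneg (by linarith),
        RCLike.norm_ofReal, abs_of_nonneg hμ]
    have h3 : μ * ‖x₀ - y‖ ≤ e - (1 - μ) := by
      refine le_of_mul_le_mul_left ?_ (show 0 < e - (1 - θ) by linarith)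
      have := mul_le_mul_of_nonneg_left hxy (show 0 ≤ 2 * (μ * θ) by positivity)
      rw [hre] at h
      calc (e - (1 - θ)) * (μ * ‖x₀ - y‖) = 2 * (μ * θ) * (k * ‖x₀ - y‖) := by rw [← hk]; ring
        _ ≤ _ := by linarith
    linarith
  · simp only
    set w : StrongDual 𝕜 X := ((‖z‖⁻¹ : ℝ) : 𝕜) • z with hw
    have hwn : ‖w‖ = 1 := by simp [w, norm_smul, hzpos.ne']
    have hzw : z = (‖z‖ : 𝕜) • w := by
      rw [hw, smul_smul, ← RCLike.ofReal_mul, mul_inv_cancel₀ hzpos.ne']; simp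
    have h1 : f - w = (θ : 𝕜) • (g - z) + (((θ * ‖z‖ : ℝ) : 𝕜) • w - w) := by
      rw [RCLike.ofReal_mul, ← smul_smul, ← hzw, hfg]; module
    have h2 : ‖f - w‖ ≤ θ * ‖g - z‖ + |θ * ‖z‖ - 1| := by
      rw [h1]
      refine (norm_add_le _ _).trans_eq ?_
      rw [norm_smul, norm_real_smul_sub_self hwn, RCLike.norm_ofReal, abs_of_nonneg hf0.le]
    have h3 := abs_le.1 (abs_norm_sub_norm_le g z)
    rw [hg] at h3
    have h4 : |θ * ‖z‖ - 1| ≤ θ * k + (1 - θ) := by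
      rw [abs_le]
      constructor <;> nlinarith
    nlinarith

/-- For `c = √(2δ)`, pairs whose norms are not both `τ`-close to `1` are approximated within some
`e ≤ c` depending only on `τ`; for `τ = 0` every pair is approximated within `c`. -/
theorem exists_dualityPair_near_of_norm_le [CompleteSpace X] [Nontrivial X] {δ c τ e : ℝ}
    (hc2 : c ^ 2 = 2 * δ) (hc : c < 2) (hτ : 0 ≤ τ) (hτc : τ ≤ (2 - c) / 2) (hec : e ≤ c)
    (hce : δ < e) (heτ : c ^ 2 - e ^ 2 ≤ (2 - c) / 2 * τ) {x : X} (hx : ‖x‖ ≤ 1)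
    {f : StrongDual 𝕜 X} (hf : ‖f‖ ≤ 1) (hfx : 1 - δ < RCLike.re (f x))
    (hxf : τ ≤ 1 - ‖x‖ ∨ τ ≤ 1 - ‖f‖) :
    ∃ p ∈ dualityPairs 𝕜 X, ‖x - p.1‖ ≤ e ∧ ‖f - p.2‖ ≤ e := by
  have hle : RCLike.re (f x) ≤ ‖f‖ * ‖x‖ := (RCLike.re_le_norm _).trans (f.le_opNorm x)
  have hx0 := norm_nonneg x
  have hf0 := norm_nonneg f
  have hxe : 1 - ‖x‖ ≤ e := by nlinarith
  have hfe : 1 - ‖f‖ < e := by nlinarith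
  rcases le_or_gt (1 + ‖f‖) e with h | h
  · obtain ⟨p, hp, h1, h2⟩ := exists_dualityPair_radial x hx f
    exact ⟨p, hp, h1.trans_le hxe, h2.trans h⟩
  · refine exists_dualityPair_near hx hf hfe h ?_
    obtain ⟨a, ha⟩ : ∃ a, a = 1 - ‖x‖ := ⟨_, rfl⟩
    obtain ⟨b, hb⟩ : ∃ b, b = 1 - ‖f‖ := ⟨_, rfl⟩
    have ha0 : 0 ≤ a := by linarith
    have hb0 : 0 ≤ b := by linarith
    -- Expanding the goal with Re f(x) > 1 - δ and c² = 2δ leaves this inequality.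
    have key : c ^ 2 - e ^ 2 ≤ (2 - e - b) * a + (2 - e) * b := by
      rcases le_or_gt τ b with hτb | hτb
      · have h1 : 0 ≤ (2 - e - b) * a := mul_nonneg (by linarith) ha0
        have h2 : (2 - c) * τ ≤ (2 - e) * b := mul_le_mul (by linarith) hτb hτ (by linarith)
        have h3 : 0 ≤ (2 - c) * τ := mul_nonneg (by linarith) hτ
        linarith
      · have hτa : τ ≤ a := by
          rcases hxf with h' | h' <;> linarith
        have h1 : 0 ≤ (2 - e) * b := mul_nonneg (by linarith) hb0
        have h2 : (2 - c) / 2 * τ ≤ (2 - e - b) * a :=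
          mul_le_mul (by linarith) hτa hτ (by linarith)
        linarith
    rw [show ‖x‖ = 1 - a by linarith, show ‖f‖ = 1 - b by linarith]
    nlinarith

/-- Pairs in the balls with norms close to `1` can be perturbed to pairs in the spheres without
leaving the region `Re x*(x) > 1 - δ`. -/
theorem exists_sphere_pair_near [Nontrivial X] {δ : ℝ} (hδ : δ ∈ Set.Ioo (0 : ℝ) 2) {η : ℝ}
    (hη : 0 < η) :
    ∃ τ > 0, ∀ (x : X) (f : StrongDual 𝕜 X), ‖x‖ ≤ 1 → ‖f‖ ≤ 1 → 1 - ‖x‖ < τ → 1 - ‖f‖ < τ →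
      1 - δ < RCLike.re (f x) → ∃ (x' : X) (f' : StrongDual 𝕜 X), ‖x'‖ = 1 ∧ ‖f'‖ = 1 ∧
        1 - δ < RCLike.re (f' x') ∧ ‖x - x'‖ < η ∧ ‖f - f'‖ < η := by
  obtain ⟨hδ0, hδ2⟩ := hδ
  obtain ⟨σ, hσ⟩ : ∃ σ, σ = min 1 η := ⟨_, rfl⟩
  have hσ0 : 0 < σ := by rw [hσ]; positivity
  have hσ1 : σ ≤ 1 := hσ ▸ min_le_left _ _
  have hση : σ ≤ η := hσ ▸ min_le_right _ _
  obtain ⟨τ, hτ⟩ : ∃ τ, τ = (2 - δ) * σ / 40 := ⟨_, rfl⟩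
  have hτ0 : 0 < τ := by
    have : 0 < 2 - δ := by linarith
    rw [hτ]
    positivity
  have hτσ : τ ≤ σ / 20 := by rw [hτ]; nlinarith
  refine ⟨τ, hτ0, fun x f hx hf hxτ hfτ hfx => ?_⟩
  obtain ⟨g, hg, hfg⟩ := exists_sphere_dist_eq 𝕜 (X := StrongDual 𝕜 X) f
  have hfre : ∀ v, RCLike.re (f v) = ‖f‖ * RCLike.re (g v) := fun v => by
    conv_lhs => rw [hfg, smul_apply, smul_eq_mul, RCLike.re_ofReal_mul]
  have hfg' : ‖f - g‖ < η := by
    nth_rw 1 [hfg]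
    rw [norm_real_smul_sub_self hg, abs_sub_comm, abs_of_nonneg (by linarith)]
    linarith
  have hfpos : 0 < ‖f‖ := by linarith
  -- Normalizing cannot lower a nonnegative value. A negative one may drop, so `x` is first pushed
  -- by `t • u`, where `u` almost norms `g`.
  rcases le_or_gt 0 (RCLike.re (f x)) with hR | hR
  · obtain ⟨x₀, hx₀, hxx₀⟩ := exists_sphere_dist_eq 𝕜 x
    have hxpos : 0 < ‖x‖ := by linarith
    have hre : RCLike.re (f x) = ‖f‖ * ‖x‖ * RCLike.re (g x₀) := by
      rw [hfre]
      conv_lhs => rw [hxx₀, g.map_smul, smul_eq_mul, RCLike.re_ofReal_mul]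
      ring
    refine ⟨x₀, g, hx₀, hg, ?_, ?_, hfg'⟩
    · have h1 : 0 < ‖f‖ * ‖x‖ := by positivity
      have h2 : ‖f‖ * ‖x‖ ≤ 1 := mul_le_one₀ hf hxpos.le hx
      have h3 : 0 ≤ RCLike.re (g x₀) := by
        rw [hre] at hR
        exact nonneg_of_mul_nonneg_right hR h1
      nlinarith
    · nth_rw 1 [hxx₀]
      rw [norm_real_smul_sub_self hx₀, abs_sub_comm, abs_of_nonneg (by linarith)]
      linarith
  · obtain ⟨u, hu, hgu⟩ : ∃ u : X, ‖u‖ ≤ 1 ∧ 1 - τ < RCLike.re (g u) := by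
      by_contra! h
      have := StrongDual.norm_le_of_re_le h
      linarith
    -- Chosen so that t(2 - δ) = 9τ, which beats the normalization loss of at most 2τ, while τ + 2t
    -- < σ.
    obtain ⟨t, ht⟩ : ∃ t, t = 9 * σ / 40 := ⟨_, rfl⟩
    have htu : ‖(t : 𝕜) • u‖ ≤ t := by
      rw [norm_smul, RCLike.norm_ofReal, abs_of_nonneg (by linarith)]
      exact mul_le_of_le_one_right (by linarith) hu
    obtain ⟨x₀, hx₀, hxx₀⟩ := exists_sphere_dist_eq 𝕜 (x + (t : 𝕜) • u)
    set ν := ‖x + (t : 𝕜) • u‖ with hν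
    have hν1 : ν ≤ 1 + t := (norm_add_le _ _).trans (by linarith)
    have hν2 : 1 - τ - t ≤ ν := by
      have := norm_sub_le (x + (t : 𝕜) • u) ((t : 𝕜) • u)
      rw [add_sub_cancel_right] at this
      linarith
    refine ⟨x₀, g, hx₀, hg, ?_, ?_, hfg'⟩
    · have hsum : RCLike.re (g x) + t * RCLike.re (g u) = ν * RCLike.re (g x₀) := by
        have := congrArg (fun v => RCLike.re (g v)) hxx₀
        simpa only [map_add, map_smul, smul_eq_mul, RCLike.re_ofReal_mul] using this
      have hGx := hfre x
      set G := RCLike.re (g x)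
      set r := RCLike.re (g x₀)
      by_contra! hr
      have hG : G < 0 := by
        rw [hGx] at hR
        exact neg_of_mul_neg_right hR hfpos.le
      have h1 : (1 - τ) * G ≥ ‖f‖ * G := by nlinarith
      have h2 : G + t * (1 - τ) ≤ (1 - τ - t) * (1 - δ) := by
        have : ν * r ≤ (1 - τ - t) * (1 - δ) := by nlinarith
        nlinarith
      have h3 : (1 - τ) * (G + t * (1 - τ)) ≤ (1 - τ) * ((1 - τ - t) * (1 - δ)) :=
        mul_le_mul_of_nonneg_left h2 (by linarith)
      have hδ1 : 0 < δ - 1 := by linarith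
      have h4 : t * (1 - τ) * (2 - δ - τ) ≤ (δ - 1) * (2 * τ) := by
        have h5 : 1 - δ ≤ (1 - τ) * G := by linarith
        have h6 : 0 ≤ (δ - 1) * τ ^ 2 := by positivity
        linear_combination h3 + h5 + h6
      have h5 : t * (2 - δ) = 9 * τ := by rw [ht, hτ]; ring
      have h6 : t * τ ≤ 1 * τ := mul_le_mul_of_nonneg_right (by linarith) hτ0.le
      have h7 : 19 / 20 * (8 * τ) ≤ (1 - τ) * (9 * τ - t * τ) :=
        mul_le_mul (by linarith) (by linarith) (by linarith) (by linarith)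
      have h8 : (δ - 1) * (2 * τ) ≤ 1 * (2 * τ) :=
        mul_le_mul_of_nonneg_right (by linarith) (by linarith)
      have h9 : t * (1 - τ) * (2 - δ - τ) = (1 - τ) * (9 * τ - t * τ) := by rw [← h5]; ring
      linarith
    · have e1 : x - x₀ = ((ν : 𝕜) • x₀ - x₀) - (t : 𝕜) • u := by rw [← hxx₀]; abel
      rw [e1]
      refine (norm_sub_le _ _).trans_lt ?_
      rw [norm_real_smul_sub_self hx₀]
      have : |ν - 1| ≤ τ + t := abs_le.2 ⟨by linarith, by linarith⟩
      linarith

theorem bpbModulus_eq_zero_of_subsingleton [Subsingleton X] (δ : ℝ) : bpbModulus 𝕜 X δ = 0 := by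
  unfold bpbModulus
  have hp : dualityPairs 𝕜 X = ∅ := by
    ext p
    simp [dualityPairs]
  have hf : ∀ (f : StrongDual 𝕜 X) x, f x = 0 := fun f x => by simp [Subsingleton.elim x 0]
  -- If 1 - δ < 0 no ε is admissible and `sInf ∅ = 0`; otherwise the condition is vacuous.
  by_cases h : 1 - δ < 0
  · convert Real.sInf_empty
    rw [Set.eq_empty_iff_forall_notMem]
    rintro ε ⟨-, hε⟩
    simpa [hp] using hε 0 0 (by simp) (by simp) (by simpa using h)
  · refine (congrArg sInf ?_).trans (csInf_Ioi (a := (0 : ℝ)))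
    ext ε
    simp [hf, h]

theorem sphericalBpbModulus_eq_zero_of_subsingleton [Subsingleton X] (δ : ℝ) :
    sphericalBpbModulus 𝕜 X δ = 0 := by
  unfold sphericalBpbModulus
  refine (congrArg sInf ?_).trans (csInf_Ioi (a := (0 : ℝ)))
  ext ε
  have : ∀ x : X, ‖x‖ ≠ 1 := fun x => by simp [Subsingleton.elim x 0]
  simp [this]

end

/-! ### Comparison of the two moduli -/

theorem proposition3p8 {𝕜 : Type*} [RCLike 𝕜] {X : Type*} [NormedAddCommGroup X]
    [NormedSpace 𝕜 X] [CompleteSpace X] (δ : ℝ) (hδ : δ ∈ Set.Ioo (0 : ℝ) 2) :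
    bpbModulus 𝕜 X δ = Real.sqrt (2 * δ) ↔ sphericalBpbModulus 𝕜 X δ = Real.sqrt (2 * δ) := by
  rcases subsingleton_or_nontrivial X with hX | hX
  · rw [bpbModulus_eq_zero_of_subsingleton, sphericalBpbModulus_eq_zero_of_subsingleton]
  have hδ0 := hδ.1
  have hδ2 := hδ.2
  have hc0 : 0 < Real.sqrt (2 * δ) := Real.sqrt_pos.2 (by linarith)
  have hc2 : Real.sqrt (2 * δ) ^ 2 = 2 * δ := Real.sq_sqrt (by linarith)
  unfold bpbModulus sphericalBpbModulus
  set c := Real.sqrt (2 * δ)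
  have hc : c < 2 := by nlinarith
  have hδc : δ < c := by nlinarith
  set A := {ε : ℝ | 0 < ε ∧ ∀ (x : X) (f : StrongDual 𝕜 X), ‖x‖ ≤ 1 → ‖f‖ ≤ 1 →
    1 - δ < RCLike.re (f x) → ∃ p ∈ dualityPairs 𝕜 X, ‖x - p.1‖ < ε ∧ ‖f - p.2‖ < ε} with hA
  set S := {ε : ℝ | 0 < ε ∧ ∀ (x : X) (f : StrongDual 𝕜 X), ‖x‖ = 1 → ‖f‖ = 1 →
    1 - δ < RCLike.re (f x) → ∃ p ∈ dualityPairs 𝕜 X, ‖x - p.1‖ < ε ∧ ‖f - p.2‖ < ε} with hS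
  have hAS : A ⊆ S := fun ε hε => ⟨hε.1, fun x f hx hf => hε.2 x f hx.le hf.le⟩
  have hAb : BddBelow A := ⟨0, fun ε hε => hε.1.le⟩
  have hSb : BddBelow S := ⟨0, fun ε hε => hε.1.le⟩
  have hcA : Set.Ioi c ⊆ A := fun ε hε => by
    refine ⟨hc0.trans hε, fun x f hx hf hfx => ?_⟩
    obtain ⟨p, hp, h1, h2⟩ := exists_dualityPair_near_of_norm_le hc2 hc le_rfl (by linarith)
      le_rfl hδc (by simp) hx hf hfx (Or.inl (by linarith))
    exact ⟨p, hp, h1.trans_lt hε, h2.trans_lt hε⟩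
  have hAc : sInf A ≤ c := by
    rw [← csInf_Ioi (a := c)]
    exact csInf_le_csInf hAb Set.nonempty_Ioi hcA
  have hSA : sInf S ≤ sInf A := csInf_le_csInf hSb (Set.nonempty_Ioi.mono hcA) hAS
  constructor
  · intro hAeq
    by_contra hne
    obtain ⟨s, hs, hsc⟩ := exists_lt_of_csInf_lt ((Set.nonempty_Ioi.mono hcA).mono hAS)
      (lt_of_le_of_ne (hSA.trans hAc) hne)
    obtain ⟨τ₀, hτ₀, hcorner⟩ := exists_sphere_pair_near (𝕜 := 𝕜) (X := X) hδ
      (show 0 < (c - s) / 2 by linarith)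
    obtain ⟨τ, hτ, hττ₀, hτc⟩ : ∃ τ, 0 < τ ∧ τ ≤ τ₀ ∧ τ ≤ (2 - c) / 2 :=
      ⟨min τ₀ ((2 - c) / 2), lt_min hτ₀ (by linarith), min_le_left _ _, min_le_right _ _⟩
    -- c² - (c - κ)² ≤ 4κ ≤ (2 - c)τ/2, and κ ≤ (c - δ)/2 keeps c - κ above δ.
    obtain ⟨κ, hκ, hκ1, hκ2⟩ : ∃ κ, 0 < κ ∧ κ ≤ (2 - c) * τ / 8 ∧ κ ≤ (c - δ) / 2 :=
      ⟨min ((2 - c) * τ / 8) ((c - δ) / 2),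
        lt_min (by have := mul_pos (sub_pos.2 hc) hτ; linarith) (by linarith),
        min_le_left _ _, min_le_right _ _⟩
    have hmem : max ((s + c) / 2) (c - κ / 2) ∈ A := by
      refine ⟨lt_max_of_lt_left (by linarith [hs.1]), fun x f hx hf hfx => ?_⟩
      by_cases h : 1 - ‖x‖ < τ ∧ 1 - ‖f‖ < τ
      · obtain ⟨x', f', hx', hf', hfx', h1, h2⟩ := hcorner x f hx hf (h.1.trans_le hττ₀)
          (h.2.trans_le hττ₀) hfx
        obtain ⟨p, hp, h3, h4⟩ := hs.2 x' f' hx' hf' hfx'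
        have h5 := norm_sub_le_norm_sub_add_norm_sub x x' p.1
        have h6 := norm_sub_le_norm_sub_add_norm_sub f f' p.2
        exact ⟨p, hp, lt_max_of_lt_left (by linarith), lt_max_of_lt_left (by linarith)⟩
      · rw [not_and_or, not_lt, not_lt] at h
        obtain ⟨p, hp, h1, h2⟩ := exists_dualityPair_near_of_norm_le (e := c - κ) hc2 hc hτ.le hτc
          (by linarith) (by linarith) (by nlinarith) hx hf hfx h
        exact ⟨p, hp, lt_max_of_lt_right (by linarith), lt_max_of_lt_right (by linarith)⟩
    have := (csInf_le hAb hmem).trans_lt (max_lt (show (s + c) / 2 < c by linarith)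
      (show c - κ / 2 < c by linarith))
    exact this.ne hAeq
  · intro hSeq
    exact le_antisymm hAc (hSeq ▸ hSA)
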